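/- For $X\in\mathbb R^{3\times 3}$ let $\operatorname{sym}X=\frac12(X+X^T)$, $\operatorname{skew}X=\frac12(X-X^T)$ and let $\|X\|$ be the Frobenius norm. For $F\in \mathrm{GL}^+(3)$ put $$W_{\mu,\mu_c}(R;F)=\mu\,\|\operatorname{sym}(R^TF-\mathbb 1)\|^2+\mu_c\,\|\operatorname{skew}(R^TF-\mathbb 1)\|^2,\qquad R\in \mathrm{SO}(3),$$ and let $\operatorname{rpolar}_{\mu,\mu_c}(F)=\operatorname{argmin}_{R\in \mathrm{SO}(3)}W_{\mu,\mu_c}(R;F)$ be the set of optimal Cosserat rotations. Let $F\in \mathrm{GL}^+(3)$ have distinct singular values $\sigma_1>\sigma_2>\sigma_3>0$, let $U=\sqrt{F^TF}$, and let $\operatorname{polar}(F)=FU^{-1}$ be its polar factor. Then there is $Q\in \mathrm{SO}(3)$ with $U=QDQ^T$, $D=\operatorname{diag}(\sigma_1,\sigma_2,\sigma_3)$. Fix any such $Q$, and let $$\widehat R^{\pm}(F)=\begin{pmatrix}\cos\hat\beta^\pm&-\sin\hat\beta^\pm&0\\ \sin\hat\beta^\pm&\cos\hat\beta^\pm&0\\0&0&1\end{pmatrix},\qquad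 \hat\beta^\pm=\begin{cases}0,&\sigma_1+\sigma_2\le 2,\\ \pm\arccos\frac{2}{\sigma_1+\sigma_2},&\sigma_1+\sigma_2\ge 2.\end{cases}$$ (i) For $(\mu,\mu_c)=(1,0)$ we have $\operatorname{rpolar}_{1,0}(F)=\{\operatorname{rpolar}^+_{1,0}(F),\operatorname{rpolar}^-_{1,0}(F)\}$, where (the two cases agree if $\sigma_1+\sigma_2=2$) $$\operatorname{rpolar}^\pm_{1,0}(F)=\begin{cases}\operatorname{polar}(F),&\sigma_1+\sigma_2\le 2,\\ \operatorname{polar}(F)\,Q\,\widehat R^{\mp}(F)\,Q^T,&\sigma_1+\sigma_2\ge 2.\end{cases}$$ (ii) For all $\mu>\mu_c\ge 0$ let $\lambda_{\mu,\mu_c}=\frac{\mu}{\mu-\mu_c}$ and $\widetilde F=\lambda_{\mu,\mu_c}^{-1}F$. Then $\operatorname{rpolar}_{\mu,\mu_c}(F)=\operatorname{rpolar}_{1,0}(\widetilde F)$; the same $Q$ diagonalizes $\sqrt{\widetilde F^T\widetilde F}$ in the sense above, and $$\operatorname{rpolar}_{\mu,\mu_c}(F)=\{\operatorname{rpolar}^+_{1,0}(\widetilde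 F),\operatorname{rpolar}^-_{1,0}(\widetilde F)\},$$ where $\operatorname{rpolar}^\pm_{1,0}(\widetilde F)$ is given by the formula in (i) with $\widetilde F$ (and its singular values $\sigma_i/\lambda_{\mu,\mu_c}$) in place of $F$. -/

import Mathlib

open scoped Matrix MatrixOrder

noncomputable section

namespace Cosserat

/-- The symmetric part `(X + Xᵀ) / 2`. -/
def symPart {n : ℕ} (X : Matrix (Fin n) (Fin n) ℝ) : Matrix (Fin n) (Fin n) ℝ :=
  (1 / 2 : ℝ) • (X + Xᵀ)

/-- The skew-symmetric part `(X - Xᵀ) / 2`. -/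
def skewPart {n : ℕ} (X : Matrix (Fin n) (Fin n) ℝ) : Matrix (Fin n) (Fin n) ℝ :=
  (1 / 2 : ℝ) • (X - Xᵀ)

/-- The squared Frobenius norm `‖X‖² = ∑ i j, X i j ^ 2`. -/
def frobSq {n : ℕ} (X : Matrix (Fin n) (Fin n) ℝ) : ℝ :=
  ∑ i, ∑ j, X i j ^ 2

/-- The Cosserat shear-stretch energy
`W_{μ,μ_c}(R; F) = μ ‖sym (RᵀF - 1)‖² + μ_c ‖skew (RᵀF - 1)‖²`. -/
def energy {n : ℕ} (μ μc : ℝ) (R F : Matrix (Fin n) (Fin n) ℝ) : ℝ :=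
  μ * frobSq (symPart (Rᵀ * F - 1)) + μc * frobSq (skewPart (Rᵀ * F - 1))

/-- The set `rpolar_{μ,μ_c}(F)` of all energy-minimizing rotations `R ∈ SO(n)`. -/
def rpolarSet {n : ℕ} (μ μc : ℝ) (F : Matrix (Fin n) (Fin n) ℝ) :
    Set (Matrix (Fin n) (Fin n) ℝ) :=
  {R | R ∈ Matrix.specialOrthogonalGroup (Fin n) ℝ ∧
    ∀ R' ∈ Matrix.specialOrthogonalGroup (Fin n) ℝ, energy μ μc R F ≤ energy μ μc R' F}

/-- The right stretch tensor `U(F) = √(FᵀF)` (positive semidefinite square root). -/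
def stretch {n : ℕ} (F : Matrix (Fin n) (Fin n) ℝ) : Matrix (Fin n) (Fin n) ℝ :=
  CFC.sqrt (Fᵀ * F)

/-- The orthogonal factor `polar(F) = F U(F)⁻¹` of the right polar decomposition
`F = polar(F) U(F)` of an invertible matrix `F`. -/
def polar {n : ℕ} (F : Matrix (Fin n) (Fin n) ℝ) : Matrix (Fin n) (Fin n) ℝ :=
  F * (stretch F)⁻¹

/-- The singular values of `F` in decreasing order. The index starts at `0`, so that
`sv F 0`, `sv F 1`, `sv F 2` are `σ₁ ≥ σ₂ ≥ σ₃`. -/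
def sv {n : ℕ} (F : Matrix (Fin n) (Fin n) ℝ) (i : ℕ) : ℝ :=
  (Matrix.toEuclideanLin F).singularValues i

/-- `Q ∈ SO(3)` is an orthonormal factor of an ordered spectral decomposition
`U(F) = Q D Qᵀ` with `D = diag(σ₁, σ₂, σ₃)`. -/
def IsPrincipalFrame (F Q : Matrix (Fin 3) (Fin 3) ℝ) : Prop :=
  Q ∈ Matrix.specialOrthogonalGroup (Fin 3) ℝ ∧
    stretch F = Q * Matrix.diagonal ![sv F 0, sv F 1, sv F 2] * Qᵀ

/-- The optimal relative rotation angle: `0` if `σ₁ + σ₂ ≤ 2`, and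
`± arccos (2 / (σ₁ + σ₂))` otherwise. The sign `±` is `ε ∈ {1, -1}`. -/
def relAngle (ε : ℤˣ) (F : Matrix (Fin 3) (Fin 3) ℝ) : ℝ :=
  if sv F 0 + sv F 1 ≤ 2 then 0
  else ((ε : ℤ) : ℝ) * Real.arccos (2 / (sv F 0 + sv F 1))

/-- The optimal relative rotation `R̂^±(F)`, a rotation about the third axis. -/
def relRot (ε : ℤˣ) (F : Matrix (Fin 3) (Fin 3) ℝ) : Matrix (Fin 3) (Fin 3) ℝ :=
  !![Real.cos (relAngle ε F), -Real.sin (relAngle ε F), 0;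
     Real.sin (relAngle ε F), Real.cos (relAngle ε F), 0;
     0, 0, 1]

/-- The branches `rpolar^±_{1,0}(F)`, relative to a choice of `Q` with `U(F) = Q D Qᵀ`. -/
def rpolarBranch (ε : ℤˣ) (F Q : Matrix (Fin 3) (Fin 3) ℝ) : Matrix (Fin 3) (Fin 3) ℝ :=
  if sv F 0 + sv F 1 ≤ 2 then polar F
  else polar F * Q * relRot (-ε) F * Qᵀ

/-- The induced scaling parameter `λ_{μ,μ_c} = μ / (μ - μ_c)`. -/
def scaling (μ μc : ℝ) : ℝ := μ / (μ - μc)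

/-- The rescaled deformation gradient `λ_{μ,μ_c}⁻¹ F`. -/
def rescaled (μ μc : ℝ) (F : Matrix (Fin 3) (Fin 3) ℝ) : Matrix (Fin 3) (Fin 3) ℝ :=
  (scaling μ μc)⁻¹ • F

end Cosserat

end

noncomputable section

namespace Cosserat

open Matrix

/-! ### Rotations -/

/-! Every rotation is `polar F * Q * S * Qᵀ` for a unique rotation `S`, and conjugation by `Q` turns
the (1, 0) energy into ‖sym(SᵀD - 1)‖² with D = diag(a, b, c). The identity 2‖sym X‖² = ‖X‖² + tr X²
and the cofactor relations of `S` make this a function of the diagonal of `S` alone. That diagonal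
ranges over a tetrahedron with barycentric coordinates 4qᵢ², `q` a unit quaternion of `S`. In these
coordinates the excess over the candidate rotation is a sum of nonnegative terms
(`optimal_relative`); equality forces the third axis to be fixed and the cosine to be `optCos`,
leaving only the sign of the sine.

For general μ > μ_c, ‖sym X‖² + ‖skew X‖² = ‖X‖² and ‖RᵀF‖ = ‖F‖ reduce the energy to the (1, 0)
energy of the rescaled gradient, up to a positive factor and a constant independent of `R`
(`energy_rescale`). -/

lemma mem_SO_iff {n : ℕ} {R : Matrix (Fin n) (Fin n) ℝ} :
    R ∈ specialOrthogonalGroup (Fin n) ℝ ↔ Rᵀ * R = 1 ∧ R.det = 1 := by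
  rw [mem_specialOrthogonalGroup_iff, mem_orthogonalGroup_iff']

lemma transpose_mem_SO {n : ℕ} {R : Matrix (Fin n) (Fin n) ℝ}
    (hR : R ∈ specialOrthogonalGroup (Fin n) ℝ) : Rᵀ ∈ specialOrthogonalGroup (Fin n) ℝ := by
  rw [mem_SO_iff] at hR ⊢
  rw [transpose_transpose, det_transpose]
  exact ⟨mul_eq_one_comm.mp hR.1, hR.2⟩

/-- A diagonal entry of a rotation equals its cofactor. -/
lemma diag_cofactor {S : Matrix (Fin 3) (Fin 3) ℝ} (hS : S ∈ specialOrthogonalGroup (Fin 3) ℝ) :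
    S 0 0 = S 1 1 * S 2 2 - S 1 2 * S 2 1 ∧ S 1 1 = S 0 0 * S 2 2 - S 0 2 * S 2 0 ∧
      S 2 2 = S 0 0 * S 1 1 - S 0 1 * S 1 0 := by
  rw [mem_SO_iff] at hS
  have h : S.adjugate = Sᵀ := by
    calc S.adjugate = Sᵀ * S * S.adjugate := by rw [hS.1, one_mul]
      _ = Sᵀ := by rw [mul_assoc, mul_adjugate, hS.2, one_smul, mul_one]
  rw [adjugate_fin_three] at h
  have h0 := congrFun (congrFun h 0) 0
  have h1 := congrFun (congrFun h 1) 1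
  have h2 := congrFun (congrFun h 2) 2
  simp at h0 h1 h2
  exact ⟨h0.symm, h1.symm, h2.symm⟩

lemma col_norm {S : Matrix (Fin 3) (Fin 3) ℝ} (hS : S ∈ specialOrthogonalGroup (Fin 3) ℝ)
    (j : Fin 3) : S 0 j ^ 2 + S 1 j ^ 2 + S 2 j ^ 2 = 1 := by
  have h := congrFun (congrFun (mem_SO_iff.mp hS).1 j) j
  simp only [mul_apply, Fin.sum_univ_three, transpose_apply, one_apply_eq] at h
  linarith

lemma row_norm {S : Matrix (Fin 3) (Fin 3) ℝ} (hS : S ∈ specialOrthogonalGroup (Fin 3) ℝ)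
    (i : Fin 3) : S i 0 ^ 2 + S i 1 ^ 2 + S i 2 ^ 2 = 1 :=
  col_norm (transpose_mem_SO hS) i

/-- The diagonal of a rotation lies in Horn's tetrahedron. -/
lemma diag_nonneg {S : Matrix (Fin 3) (Fin 3) ℝ} (hS : S ∈ specialOrthogonalGroup (Fin 3) ℝ) :
    0 ≤ 1 + S 0 0 - S 1 1 - S 2 2 ∧ 0 ≤ 1 - S 0 0 + S 1 1 - S 2 2 ∧
      0 ≤ 1 - S 0 0 - S 1 1 + S 2 2 := by
  obtain ⟨h0, h1, h2⟩ := diag_cofactor hS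
  have c0 := col_norm hS 0
  have c1 := col_norm hS 1
  have c2 := col_norm hS 2
  refine ⟨?_, ?_, ?_⟩
  -- For a unit quaternion `q` of `S`, the squared terms are, up to order, 16 q₁² qⱼ², which sum to
  -- 16 q₁².
  · have : 4 * (1 + S 0 0 - S 1 1 - S 2 2) = (1 + S 0 0 - S 1 1 - S 2 2) ^ 2 +
        (S 0 1 + S 1 0) ^ 2 + (S 0 2 + S 2 0) ^ 2 + (S 1 2 - S 2 1) ^ 2 := by
      linear_combination -c0 - c1 - c2 + 2 * h0 - 2 * h1 - 2 * h2
    nlinarith [sq_nonneg (1 + S 0 0 - S 1 1 - S 2 2), sq_nonneg (S 0 1 + S 1 0),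
      sq_nonneg (S 0 2 + S 2 0), sq_nonneg (S 1 2 - S 2 1)]
  · have : 4 * (1 - S 0 0 + S 1 1 - S 2 2) = (1 - S 0 0 + S 1 1 - S 2 2) ^ 2 +
        (S 0 1 + S 1 0) ^ 2 + (S 0 2 - S 2 0) ^ 2 + (S 1 2 + S 2 1) ^ 2 := by
      linear_combination -c0 - c1 - c2 - 2 * h0 + 2 * h1 - 2 * h2
    nlinarith [sq_nonneg (1 - S 0 0 + S 1 1 - S 2 2), sq_nonneg (S 0 1 + S 1 0),
      sq_nonneg (S 0 2 - S 2 0), sq_nonneg (S 1 2 + S 2 1)]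
  · have : 4 * (1 - S 0 0 - S 1 1 + S 2 2) = (1 - S 0 0 - S 1 1 + S 2 2) ^ 2 +
        (S 0 1 - S 1 0) ^ 2 + (S 0 2 + S 2 0) ^ 2 + (S 1 2 + S 2 1) ^ 2 := by
      linear_combination -c0 - c1 - c2 - 2 * h0 - 2 * h1 + 2 * h2
    nlinarith [sq_nonneg (1 - S 0 0 - S 1 1 + S 2 2), sq_nonneg (S 0 1 - S 1 0),
      sq_nonneg (S 0 2 + S 2 0), sq_nonneg (S 1 2 + S 2 1)]

/-- The rotation about the third axis with cosine `c` and sine `s`. -/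
def axisRot (c s : ℝ) : Matrix (Fin 3) (Fin 3) ℝ := !![c, -s, 0; s, c, 0; 0, 0, 1]

lemma axisRot_mem_SO {c s : ℝ} (h : c ^ 2 + s ^ 2 = 1) :
    axisRot c s ∈ specialOrthogonalGroup (Fin 3) ℝ := by
  rw [mem_SO_iff]
  constructor
  · ext i j
    fin_cases i <;> fin_cases j <;> simp [axisRot, mul_apply, Fin.sum_univ_three] <;> linarith
  · simp [axisRot, det_fin_three]
    linarith

/-- A rotation with third diagonal entry `1` and first diagonal entry `c` is a rotation about the
third axis. -/
lemma eq_axisRot {S : Matrix (Fin 3) (Fin 3) ℝ} (hS : S ∈ specialOrthogonalGroup (Fin 3) ℝ)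
    {c s : ℝ} (h : c ^ 2 + s ^ 2 = 1) (h0 : S 0 0 = c) (h1 : S 1 1 = c) (h2 : S 2 2 = 1) :
    S = axisRot c (-s) ∨ S = axisRot c s := by
  have c2 := col_norm hS 2
  have r2 := row_norm hS 2
  have c0 := col_norm hS 0
  obtain ⟨-, -, k⟩ := diag_cofactor hS
  rw [h2] at c2 r2 k
  rw [h0, h1] at k
  have e02 : S 0 2 = 0 := by nlinarith [sq_nonneg (S 0 2), sq_nonneg (S 1 2)]
  have e12 : S 1 2 = 0 := by nlinarith [sq_nonneg (S 0 2), sq_nonneg (S 1 2)]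
  have e20 : S 2 0 = 0 := by nlinarith [sq_nonneg (S 2 0), sq_nonneg (S 2 1)]
  have e21 : S 2 1 = 0 := by nlinarith [sq_nonneg (S 2 0), sq_nonneg (S 2 1)]
  rw [h0, e20] at c0
  have c1 := col_norm hS 1
  rw [h1, e21] at c1
  have e01 : S 0 1 = -S 1 0 := by nlinarith [sq_nonneg (S 0 1 + S 1 0)]
  have hs : S 1 0 = s ∨ S 1 0 = -s := sq_eq_sq_iff_eq_or_eq_neg.mp (by linarith)
  rcases hs with hs | hs
  · right
    ext i j
    fin_cases i <;> fin_cases j <;> simp [axisRot, *]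
  · left
    ext i j
    fin_cases i <;> fin_cases j <;> simp [axisRot, *]

/-! ### The energy of a relative rotation -/

/-- The shear-stretch energy of `S` with respect to a diagonal stretch only depends on the diagonal
of `S`. -/
lemma frobSq_symPart_diagonal {S : Matrix (Fin 3) (Fin 3) ℝ}
    (hS : S ∈ specialOrthogonalGroup (Fin 3) ℝ) (a b c : ℝ) :
    frobSq (symPart (Sᵀ * diagonal ![a, b, c] - 1)) =
      (a * S 0 0 + b * S 1 1 + c * S 2 2 - 2) ^ 2 / 2 + 1 + (a ^ 2 + b ^ 2 + c ^ 2) / 2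
        - (b * c * S 0 0 + a * c * S 1 1 + a * b * S 2 2) := by
  obtain ⟨h0, h1, h2⟩ := diag_cofactor hS
  have c0 := row_norm hS 0
  have c1 := row_norm hS 1
  have c2 := row_norm hS 2
  simp [frobSq, symPart, Fin.sum_univ_three, mul_diagonal, one_apply]
  -- Row norms evaluate ‖SᵀD‖²; cofactors trade the products `S i j * S j i` for diagonal entries.
  linear_combination (a ^ 2 / 2) * c0 + (b ^ 2 / 2) * c1 + (c ^ 2 / 2) * c2 + b * c * h0
    + a * c * h1 + a * b * h2

/-- The cosine of the optimal relative rotation angle. -/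
def optCos (a b : ℝ) : ℝ := if a + b ≤ 2 then 1 else 2 / (a + b)

/-- The second part is the equality case, which yields uniqueness of the minimizers up to the sign
of `s`. -/
lemma optimal_relative {S : Matrix (Fin 3) (Fin 3) ℝ}
    (hS : S ∈ specialOrthogonalGroup (Fin 3) ℝ) {a b c s : ℝ} (hc : 0 < c) (hcb : c < b)
    (hba : b < a) (hs : optCos a b ^ 2 + s ^ 2 = 1) :
    frobSq (symPart ((axisRot (optCos a b) s)ᵀ * diagonal ![a, b, c] - 1)) ≤
        frobSq (symPart (Sᵀ * diagonal ![a, b, c] - 1)) ∧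
      (frobSq (symPart (Sᵀ * diagonal ![a, b, c] - 1)) ≤
        frobSq (symPart ((axisRot (optCos a b) s)ᵀ * diagonal ![a, b, c] - 1)) →
        S = axisRot (optCos a b) (-s) ∨ S = axisRot (optCos a b) s) := by
  obtain ⟨p, q, r⟩ := diag_nonneg hS
  rw [frobSq_symPart_diagonal hS, frobSq_symPart_diagonal (axisRot_mem_SO hs)]
  set x := 1 + S 0 0 - S 1 1 - S 2 2 with hx
  set y := 1 - S 0 0 + S 1 1 - S 2 2 with hy
  set z := 1 - S 0 0 - S 1 1 + S 2 2 with hz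
  set C := optCos a b with hC
  have hP : 0 ≤ (a - c) * (x * (b + c)) := mul_nonneg (by linarith) (mul_nonneg p (by linarith))
  have hQ : 0 ≤ (b - c) * (y * (a + c)) := mul_nonneg (by linarith) (mul_nonneg q (by linarith))
  have hR : 0 ≤ z * (a + b) := mul_nonneg r (by linarith)
  have hP' : 0 ≤ x * (b + c) := mul_nonneg p (by linarith)
  have hQ' : 0 ≤ y * (a + c) := mul_nonneg q (by linarith)
  -- With L = x(b+c) + y(a+c) + z(a+b) = 2(tr D - tr SD), the candidate has x = y = 0 and L =
  -- 2(1-C)(a+b). The excess is expanded around this value.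
  have key : ((a * S 0 0 + b * S 1 1 + c * S 2 2 - 2) ^ 2 / 2 + 1 + (a ^ 2 + b ^ 2 + c ^ 2) / 2
        - (b * c * S 0 0 + a * c * S 1 1 + a * b * S 2 2)) -
      ((a * (axisRot C s) 0 0 + b * (axisRot C s) 1 1 + c * (axisRot C s) 2 2 - 2) ^ 2 / 2
        + 1 + (a ^ 2 + b ^ 2 + c ^ 2) / 2
        - (b * c * (axisRot C s) 0 0 + a * c * (axisRot C s) 1 1 + a * b * (axisRot C s) 2 2)) =
      (x * (b + c) + y * (a + c) + z * (a + b) - 2 * (1 - C) * (a + b)) ^ 2 / 8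
       + (2 - C * (a + b)) * (x * (b + c) + y * (a + c) + z * (a + b) - 2 * (1 - C) * (a + b)) / 2
       + (a - c) * (x * (b + c)) / 2 + (b - c) * (y * (a + c)) / 2 := by
    simp [axisRot, hx, hy, hz]
    ring
  -- Complementarity: either C = 1 and both factors are nonnegative, or C(a+b) = 2 and the first
  -- vanishes.
  have hT : 0 ≤ (2 - C * (a + b)) *
      (x * (b + c) + y * (a + c) + z * (a + b) - 2 * (1 - C) * (a + b)) := by
    rw [hC, optCos]
    split_ifs with h
    · exact mul_nonneg (by linarith) (by linarith)
    · rw [div_mul_cancel₀ _ (by linarith), sub_self, zero_mul]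
  have hsq := sq_nonneg (x * (b + c) + y * (a + c) + z * (a + b) - 2 * (1 - C) * (a + b))
  refine ⟨by linarith, fun hle => ?_⟩
  have x0 : x = 0 := by
    have : (a - c) * (b + c) * x = 0 := by linarith
    exact (mul_eq_zero.mp this).resolve_left
      (mul_pos (by linarith) (by linarith)).ne'
  have y0 : y = 0 := by
    have : (b - c) * (a + c) * y = 0 := by linarith
    exact (mul_eq_zero.mp this).resolve_left
      (mul_pos (by linarith) (by linarith)).ne'
  have z0 : z = 2 * (1 - C) := by
    have h : (x * (b + c) + y * (a + c) + z * (a + b) - 2 * (1 - C) * (a + b)) ^ 2 = 0 := by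
      linarith
    have h' := pow_eq_zero_iff (two_ne_zero) |>.mp h
    rw [x0, y0] at h'
    have : (a + b) * (z - 2 * (1 - C)) = 0 := by linarith
    linarith [(mul_eq_zero.mp this).resolve_left (by linarith)]
  exact eq_axisRot hS hs (by linarith) (by linarith) (by linarith)

/-! ### Singular values and the stretch -/

lemma adjoint_comp_toEuclideanLin {n : ℕ} (F : Matrix (Fin n) (Fin n) ℝ) :
    (toEuclideanLin F).adjoint ∘ₗ toEuclideanLin F = toEuclideanLin (Fᵀ * F) := by
  rw [← toEuclideanLin_conjTranspose_eq_adjoint, conjTranspose_eq_transpose_of_trivial]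
  ext v i
  simp [toLpLin_apply, mulVec_mulVec]

lemma sv_nonneg {n : ℕ} (F : Matrix (Fin n) (Fin n) ℝ) (i : ℕ) : 0 ≤ sv F i :=
  LinearMap.singularValues_nonneg _ _

lemma exists_orthogonal_diagonalization {n : ℕ} (F : Matrix (Fin n) (Fin n) ℝ) :
    ∃ O : Matrix (Fin n) (Fin n) ℝ, Oᵀ * O = 1 ∧
      Fᵀ * F = O * diagonal (fun i : Fin n => sv F i ^ 2) * Oᵀ := by
  have hn : Module.finrank ℝ (EuclideanSpace ℝ (Fin n)) = n := finrank_euclideanSpace_fin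
  let T := toEuclideanLin F
  let b := T.isSymmetric_adjoint_comp_self.eigenvectorBasis hn
  let O : Matrix (Fin n) (Fin n) ℝ := of fun i j => b j i
  have hO : Oᵀ * O = 1 := by
    ext i j
    have := orthonormal_iff_ite.mp b.orthonormal i j
    rw [PiLp.inner_apply] at this
    simp only [mul_apply, transpose_apply, O, of_apply, one_apply, ← this]
    exact Finset.sum_congr rfl fun k _ => by simp [mul_comm]
  refine ⟨O, hO, ?_⟩
  have h : Fᵀ * F * O = O * diagonal (fun i : Fin n => sv F i ^ 2) := by
    ext i j
    have hb := T.isSymmetric_adjoint_comp_self.apply_eigenvectorBasis hn j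
    rw [← T.sq_singularValues_fin hn] at hb
    replace hb := (LinearMap.congr_fun (adjoint_comp_toEuclideanLin F) _).symm.trans hb
    have := congrArg (fun v : EuclideanSpace ℝ (Fin n) => v i) hb
    simp [toLpLin_apply, mulVec, dotProduct] at this
    rw [mul_diagonal, mul_apply]
    simp only [O, of_apply, sv]
    rw [mul_comm (b j i)]
    exact this
  rw [← h, mul_assoc, mul_eq_one_comm.mp hO, mul_one]

/-- Singular values are determined by an ordered diagonalization of `FᵀF`. -/
lemma sv_eq_of_diagonalization {n : ℕ} {F O : Matrix (Fin n) (Fin n) ℝ} {d : Fin n → ℝ}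
    (hd : ∀ i, 0 ≤ d i) (hanti : Antitone d) (hO : Oᵀ * O = 1)
    (h : Fᵀ * F = O * diagonal (fun i => d i ^ 2) * Oᵀ) (i : Fin n) : sv F i = d i := by
  have hn : Module.finrank ℝ (EuclideanSpace ℝ (Fin n)) = n := finrank_euclideanSpace_fin
  let T := toEuclideanLin F
  have hS := T.isSymmetric_adjoint_comp_self
  have hc : (T.adjoint ∘ₗ T).charpoly = (diagonal fun i => d i ^ 2).charpoly := by
    rw [adjoint_comp_toEuclideanLin, toEuclideanLin, toLpLin_eq_toLin, ← LinearMap.charpoly_toMatrix _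
      (PiLp.basisFun 2 ℝ (Fin n)), LinearMap.toMatrix_toLin, h, charpoly_mul_comm, ← mul_assoc,
      hO, one_mul]
  have hsort := hS.sort_roots_charpoly_eq_eigenvalues hn
  have hroots : (T.adjoint ∘ₗ T).charpoly.roots = Multiset.ofList (List.ofFn fun i => d i ^ 2) := by
    rw [hc, charpoly_diagonal, Polynomial.roots_prod _ _
      (Finset.prod_ne_zero_iff.mpr fun i _ => Polynomial.X_sub_C_ne_zero _)]
    simp only [Polynomial.roots_X_sub_C, Multiset.bind_singleton, Fin.univ_val_map]
  have hanti2 : Antitone fun i => d i ^ 2 := fun i j hij =>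
    pow_le_pow_left₀ (hd j) (hanti hij) 2
  -- Both lists are the decreasingly sorted roots of one characteristic polynomial; sorting fixes
  -- the already ordered `d i ^ 2`.
  have hlist : List.ofFn (hS.eigenvalues hn) = List.ofFn fun i => d i ^ 2 := by
    rw [← hsort, hroots, Multiset.map_coe, Multiset.coe_sort]
    have : (List.ofFn fun i => d i ^ 2).map RCLike.re = List.ofFn fun i => d i ^ 2 := by
      simp [List.map_ofFn, Function.comp_def]
    rw [this]
    apply List.mergeSort_of_pairwise
    simp_rw [decide_eq_true_eq, ← List.sortedGE_iff_pairwise]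
    exact hanti2.sortedGE_ofFn
  have := congrFun (List.ofFn_injective hlist) i
  rw [sv, T.singularValues_fin hn, this, Real.sqrt_sq (hd i)]

lemma stretch_eq_of_diagonalization {n : ℕ} {F O : Matrix (Fin n) (Fin n) ℝ} {d : Fin n → ℝ}
    (hd : ∀ i, 0 ≤ d i) (hO : Oᵀ * O = 1)
    (h : Fᵀ * F = O * diagonal (fun i => d i ^ 2) * Oᵀ) : stretch F = O * diagonal d * Oᵀ := by
  have hpos : 0 ≤ O * diagonal d * Oᵀ := by
    rw [nonneg_iff_posSemidef]
    have := (posSemidef_diagonal_iff.mpr hd).mul_mul_conjTranspose_same O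
    rwa [conjTranspose_eq_transpose_of_trivial] at this
  refine CFC.sqrt_unique ?_ hpos
  calc O * diagonal d * Oᵀ * (O * diagonal d * Oᵀ)
      = O * diagonal d * (Oᵀ * O) * diagonal d * Oᵀ := by simp only [mul_assoc]
    _ = Fᵀ * F := by
      rw [hO, mul_one, h, mul_assoc O, diagonal_mul_diagonal]
      simp only [pow_two]

lemma stretch_mul_self {n : ℕ} (F : Matrix (Fin n) (Fin n) ℝ) : stretch F * stretch F = Fᵀ * F := by
  refine CFC.sqrt_mul_sqrt_self _ ?_
  rw [nonneg_iff_posSemidef]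
  have := posSemidef_conjTranspose_mul_self F
  rwa [conjTranspose_eq_transpose_of_trivial] at this

/-! ### Principal frames and the polar factor -/

lemma principal_nonneg (F : Matrix (Fin 3) (Fin 3) ℝ) (i : Fin 3) :
    0 ≤ (![sv F 0, sv F 1, sv F 2] : Fin 3 → ℝ) i := by
  fin_cases i <;> exact sv_nonneg _ _

lemma principal_antitone (F : Matrix (Fin 3) (Fin 3) ℝ) :
    Antitone (![sv F 0, sv F 1, sv F 2] : Fin 3 → ℝ) := by
  have h : (![sv F 0, sv F 1, sv F 2] : Fin 3 → ℝ) = fun i : Fin 3 => sv F i := by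
    ext i; fin_cases i <;> rfl
  rw [h]
  exact fun i j hij => (toEuclideanLin F).singularValues_antitone hij

lemma exists_isPrincipalFrame (F : Matrix (Fin 3) (Fin 3) ℝ) : ∃ Q, IsPrincipalFrame F Q := by
  obtain ⟨O, hO, h⟩ := exists_orthogonal_diagonalization F
  have hd : (fun i : Fin 3 => sv F i ^ 2) = fun i => (![sv F 0, sv F 1, sv F 2] i) ^ 2 := by
    ext i; fin_cases i <;> rfl
  rw [hd] at h
  have hs := stretch_eq_of_diagonalization (principal_nonneg F) hO h
  have hdet : O.det * O.det = 1 := by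
    have := congrArg det hO
    rwa [det_mul, det_transpose, det_one] at this
  -- In odd dimension, negating `O` flips the determinant and leaves the conjugation by `O`
  -- unchanged.
  rcases mul_self_eq_one_iff.mp hdet with h1 | h1
  · exact ⟨O, mem_SO_iff.mpr ⟨hO, h1⟩, hs⟩
  · refine ⟨-O, mem_SO_iff.mpr ⟨by simpa using hO, by norm_num [det_neg, h1]⟩, by simpa using hs⟩

lemma IsPrincipalFrame.diagonalization {F Q : Matrix (Fin 3) (Fin 3) ℝ}
    (h : IsPrincipalFrame F Q) :
    Fᵀ * F = Q * diagonal (fun i => (![sv F 0, sv F 1, sv F 2] : Fin 3 → ℝ) i ^ 2) * Qᵀ := by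
  rw [← stretch_mul_self, h.2]
  calc _ = Q * diagonal ![sv F 0, sv F 1, sv F 2] * (Qᵀ * Q) *
        diagonal ![sv F 0, sv F 1, sv F 2] * Qᵀ := by simp only [mul_assoc]
    _ = _ := by
      rw [(mem_SO_iff.mp h.1).1, mul_one, mul_assoc Q, diagonal_mul_diagonal]
      simp only [pow_two]

/-- A nonnegative factor preserves the order of the diagonal, so the scaled decomposition is still
the ordered one. -/
lemma IsPrincipalFrame.smul {F Q : Matrix (Fin 3) (Fin 3) ℝ} (h : IsPrincipalFrame F Q)
    {c : ℝ} (hc : 0 ≤ c) :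
    IsPrincipalFrame (c • F) Q ∧ sv (c • F) 0 = c * sv F 0 ∧ sv (c • F) 1 = c * sv F 1 ∧
      sv (c • F) 2 = c * sv F 2 := by
  have hQ := (mem_SO_iff.mp h.1).1
  have hd : ∀ i, 0 ≤ (c • ![sv F 0, sv F 1, sv F 2] : Fin 3 → ℝ) i := fun i =>
    mul_nonneg hc (principal_nonneg F i)
  have hanti : Antitone (c • ![sv F 0, sv F 1, sv F 2] : Fin 3 → ℝ) := fun i j hij =>
    mul_le_mul_of_nonneg_left (principal_antitone F hij) hc
  have hF : (c • F)ᵀ * (c • F) =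
      Q * diagonal (fun i => (c • ![sv F 0, sv F 1, sv F 2] : Fin 3 → ℝ) i ^ 2) * Qᵀ := by
    have hdiag : diagonal (fun i => (c • ![sv F 0, sv F 1, sv F 2] : Fin 3 → ℝ) i ^ 2) =
        (c * c) • diagonal (fun i => (![sv F 0, sv F 1, sv F 2] : Fin 3 → ℝ) i ^ 2) := by
      rw [← diagonal_smul]
      congr 1
      ext i
      simp only [Pi.smul_apply, smul_eq_mul]
      ring
    rw [hdiag, transpose_smul, Matrix.smul_mul, Matrix.mul_smul, smul_smul, h.diagonalization, Matrix.mul_smul, Matrix.smul_mul]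
  have hsv := sv_eq_of_diagonalization hd hanti hQ hF
  have h0 : sv (c • F) 0 = c * sv F 0 := hsv 0
  have h1 : sv (c • F) 1 = c * sv F 1 := hsv 1
  have h2 : sv (c • F) 2 = c * sv F 2 := hsv 2
  refine ⟨⟨h.1, ?_⟩, h0, h1, h2⟩
  rw [stretch_eq_of_diagonalization hd hQ hF, h0, h1, h2]
  simp

lemma IsPrincipalFrame.det_stretch {F Q : Matrix (Fin 3) (Fin 3) ℝ} (h : IsPrincipalFrame F Q) :
    (stretch F).det = sv F 0 * sv F 1 * sv F 2 := by
  obtain ⟨hQ, hdet⟩ := mem_SO_iff.mp h.1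
  rw [h.2, det_mul, det_mul, det_transpose, hdet, det_diagonal, Fin.prod_univ_three]
  simp

lemma IsPrincipalFrame.det_stretch_eq {F Q : Matrix (Fin 3) (Fin 3) ℝ}
    (h : IsPrincipalFrame F Q) (hF : 0 < F.det) : (stretch F).det = F.det := by
  have h1 := congrArg det (stretch_mul_self F)
  rw [det_mul, det_mul, det_transpose] at h1
  have h2 : 0 ≤ (stretch F).det := by
    rw [h.det_stretch]
    exact mul_nonneg (mul_nonneg (sv_nonneg _ _) (sv_nonneg _ _)) (sv_nonneg _ _)
  nlinarith

lemma IsPrincipalFrame.sv_two_pos {F Q : Matrix (Fin 3) (Fin 3) ℝ}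
    (h : IsPrincipalFrame F Q) (hF : 0 < F.det) : 0 < sv F 2 := by
  refine (sv_nonneg F 2).lt_of_ne fun h0 => hF.ne ?_
  rw [← h.det_stretch_eq hF, h.det_stretch, ← h0, mul_zero]

lemma IsPrincipalFrame.polar_mul_stretch {F Q : Matrix (Fin 3) (Fin 3) ℝ}
    (h : IsPrincipalFrame F Q) (hF : 0 < F.det) : polar F * stretch F = F :=
  nonsing_inv_mul_cancel_right _ _ (by rw [h.det_stretch_eq hF]; exact hF.ne'.isUnit)

lemma IsPrincipalFrame.polar_mem_SO {F Q : Matrix (Fin 3) (Fin 3) ℝ}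
    (h : IsPrincipalFrame F Q) (hF : 0 < F.det) :
    polar F ∈ specialOrthogonalGroup (Fin 3) ℝ := by
  have hu : IsUnit (stretch F).det := by rw [h.det_stretch_eq hF]; exact hF.ne'.isUnit
  have hsymm : (stretch F)ᵀ = stretch F := by
    rw [h.2]
    simp [transpose_mul, mul_assoc]
  rw [mem_SO_iff]
  constructor
  · rw [polar, transpose_mul, transpose_nonsing_inv, hsymm, mul_assoc, ← mul_assoc Fᵀ,
      ← stretch_mul_self, mul_assoc, mul_nonsing_inv _ hu, mul_one, nonsing_inv_mul _ hu]
  · have := congrArg det (h.polar_mul_stretch hF)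
    rw [det_mul, h.det_stretch_eq hF] at this
    exact mul_right_cancel₀ hF.ne' (this.trans (one_mul _).symm)

/-! ### Reduction to the relative rotation -/

lemma frobSq_eq_trace {n : ℕ} (X : Matrix (Fin n) (Fin n) ℝ) : frobSq X = trace (Xᵀ * X) := by
  simp only [frobSq, trace, diag_apply, mul_apply, transpose_apply, pow_two]
  exact Finset.sum_comm

lemma frobSq_conj {n : ℕ} {Q : Matrix (Fin n) (Fin n) ℝ} (hQ : Qᵀ * Q = 1)
    (X : Matrix (Fin n) (Fin n) ℝ) : frobSq (Q * X * Qᵀ) = frobSq X := by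
  rw [frobSq_eq_trace, frobSq_eq_trace]
  calc trace ((Q * X * Qᵀ)ᵀ * (Q * X * Qᵀ)) = trace (Q * (Xᵀ * (Qᵀ * Q) * X) * Qᵀ) := by
        simp only [transpose_mul, transpose_transpose, mul_assoc]
    _ = trace (Xᵀ * X) := by
        rw [trace_mul_comm, ← mul_assoc, hQ, one_mul, mul_one]

lemma symPart_conj {n : ℕ} (Q X : Matrix (Fin n) (Fin n) ℝ) :
    symPart (Q * X * Qᵀ) = Q * symPart X * Qᵀ := by
  simp [symPart, transpose_mul, mul_assoc, mul_add, add_mul]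

lemma IsPrincipalFrame.energy_eq {F Q : Matrix (Fin 3) (Fin 3) ℝ}
    (h : IsPrincipalFrame F Q) (hF : 0 < F.det) (S : Matrix (Fin 3) (Fin 3) ℝ) :
    energy 1 0 (polar F * Q * S * Qᵀ) F =
      frobSq (symPart (Sᵀ * diagonal ![sv F 0, sv F 1, sv F 2] - 1)) := by
  have hQ := (mem_SO_iff.mp h.1).1
  have hP := (mem_SO_iff.mp (h.polar_mem_SO hF)).1
  have key : (polar F * Q * S * Qᵀ)ᵀ * F - 1 =
      Q * (Sᵀ * diagonal ![sv F 0, sv F 1, sv F 2] - 1) * Qᵀ := by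
    have hPF : (polar F)ᵀ * F = Q * diagonal ![sv F 0, sv F 1, sv F 2] * Qᵀ := by
      rw [← h.2]
      nth_rewrite 2 [← h.polar_mul_stretch hF]
      rw [← mul_assoc, hP, one_mul]
    rw [mul_sub, sub_mul, mul_one, mul_eq_one_comm.mp hQ]
    congr 1
    calc (polar F * Q * S * Qᵀ)ᵀ * F = Q * Sᵀ * Qᵀ * ((polar F)ᵀ * F) := by
          simp only [transpose_mul, transpose_transpose, mul_assoc]
      _ = Q * Sᵀ * (Qᵀ * Q) * diagonal ![sv F 0, sv F 1, sv F 2] * Qᵀ := by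
          rw [hPF]; simp only [mul_assoc]
      _ = _ := by rw [hQ, mul_one]; simp only [mul_assoc]
  rw [energy, one_mul, zero_mul, add_zero, key, symPart_conj, frobSq_conj hQ]

/-! ### The optimal relative rotations -/

/-- The sign of the angle survives only in the sine, which vanishes when `optCos` is 1. -/
lemma relRot_eq (ε : ℤˣ) (F : Matrix (Fin 3) (Fin 3) ℝ) (h0 : 0 < sv F 0 + sv F 1) :
    relRot ε F = axisRot (optCos (sv F 0) (sv F 1))
      (((ε : ℤ) : ℝ) * √(1 - optCos (sv F 0) (sv F 1) ^ 2)) := by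
  have hc : Real.cos (relAngle ε F) = optCos (sv F 0) (sv F 1) ∧ Real.sin (relAngle ε F) =
      ((ε : ℤ) : ℝ) * √(1 - optCos (sv F 0) (sv F 1) ^ 2) := by
    unfold relAngle optCos
    split_ifs with h
    · simp
    · have h1 : 2 / (sv F 0 + sv F 1) ≤ 1 := (div_le_one h0).mpr (by linarith)
      have h2 : 0 ≤ 2 / (sv F 0 + sv F 1) := by positivity
      rcases Int.units_eq_one_or ε with rfl | rfl <;>
        simp [Real.cos_arccos (by linarith) h1, Real.sin_arccos]
  rw [relRot, hc.1, hc.2, axisRot]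

/-- For σ₁ + σ₂ ≤ 2 the angle is 0, so one formula serves both regimes. -/
lemma rpolarBranch_eq {F Q : Matrix (Fin 3) (Fin 3) ℝ}
    (hQ : Q ∈ specialOrthogonalGroup (Fin 3) ℝ) (ε : ℤˣ) :
    rpolarBranch ε F Q = polar F * Q * relRot (-ε) F * Qᵀ := by
  unfold rpolarBranch
  split_ifs with h
  · have : relRot (-ε) F = 1 := by
      ext i j
      fin_cases i <;> fin_cases j <;> simp [relRot, relAngle, h]
    rw [this, mul_one, mul_assoc, mul_eq_one_comm.mp (mem_SO_iff.mp hQ).1, mul_one]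
  · rfl

lemma IsPrincipalFrame.rpolarSet_eq {F Q : Matrix (Fin 3) (Fin 3) ℝ}
    (h : IsPrincipalFrame F Q) (hF : 0 < F.det) (h12 : sv F 1 < sv F 0) (h23 : sv F 2 < sv F 1) :
    rpolarSet 1 0 F =
      {polar F * Q * relRot (-1) F * Qᵀ, polar F * Q * relRot 1 F * Qᵀ} := by
  have hc := h.sv_two_pos hF
  have hP := h.polar_mem_SO hF
  have hQ' := (mem_SO_iff.mp h.1).1
  have hPP := mul_eq_one_comm.mp (mem_SO_iff.mp hP).1
  have hQQ := mul_eq_one_comm.mp hQ'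
  set C := optCos (sv F 0) (sv F 1) with hC
  set s := √(1 - C ^ 2) with hs
  have hC1 : C ^ 2 ≤ 1 := by
    rw [hC, optCos]
    split_ifs with h
    · norm_num
    · have h1 : 2 / (sv F 0 + sv F 1) ≤ 1 := (div_le_one (by linarith)).mpr (by linarith)
      exact pow_le_one₀ (div_nonneg (by norm_num) (by linarith)) h1
  have hCs : C ^ 2 + s ^ 2 = 1 := by
    rw [hs, Real.sq_sqrt (by linarith)]
    ring
  have hCs' : C ^ 2 + (-s) ^ 2 = 1 := by rw [neg_sq, hCs]
  have r1 : relRot 1 F = axisRot C s := by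
    rw [relRot_eq _ _ (by linarith)]; simp [hs, hC]
  have r2 : relRot (-1) F = axisRot C (-s) := by
    rw [relRot_eq _ _ (by linarith)]; simp [hs, hC]
  have hlift : ∀ {S}, S ∈ specialOrthogonalGroup (Fin 3) ℝ →
      polar F * Q * S * Qᵀ ∈ specialOrthogonalGroup (Fin 3) ℝ := fun hS =>
    mul_mem (mul_mem (mul_mem hP h.1) hS) (transpose_mem_SO h.1)
  -- Surjectivity of the substitution: minimizing over `R` is minimizing over `S`.
  have hdrop : ∀ {R}, R ∈ specialOrthogonalGroup (Fin 3) ℝ →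
      ∃ S ∈ specialOrthogonalGroup (Fin 3) ℝ, R = polar F * Q * S * Qᵀ := fun {R} hR => by
    refine ⟨Qᵀ * (polar F)ᵀ * R * Q, mul_mem (mul_mem (mul_mem (transpose_mem_SO h.1)
      (transpose_mem_SO hP)) hR) h.1, ?_⟩
    calc R = polar F * (Q * Qᵀ) * (polar F)ᵀ * R * (Q * Qᵀ) := by
          rw [hQQ, mul_one, mul_one, hPP, one_mul]
      _ = _ := by simp only [mul_assoc]
  have hmin : ∀ t : ℝ, C ^ 2 + t ^ 2 = 1 →
      polar F * Q * axisRot C t * Qᵀ ∈ rpolarSet 1 0 F := fun t ht => by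
    refine ⟨hlift (axisRot_mem_SO ht), fun R hR => ?_⟩
    obtain ⟨S, hS, rfl⟩ := hdrop hR
    rw [h.energy_eq hF, h.energy_eq hF]
    exact (optimal_relative hS hc h23 h12 ht).1
  rw [r1, r2]
  refine Set.Subset.antisymm ?_ ?_
  · rintro R ⟨hR, hle⟩
    obtain ⟨S, hS, rfl⟩ := hdrop hR
    have := hle _ (hlift (axisRot_mem_SO hCs))
    rw [h.energy_eq hF, h.energy_eq hF] at this
    rcases (optimal_relative hS hc h23 h12 hCs).2 this with rfl | rfl
    · exact Or.inl rfl
    · exact Or.inr rfl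
  · rintro R (rfl | rfl)
    · exact hmin _ hCs'
    · exact hmin _ hCs

/-! ### Reduction of the parameters -/

lemma frobSq_transpose_mul {n : ℕ} {R : Matrix (Fin n) (Fin n) ℝ} (hR : Rᵀ * R = 1)
    (F : Matrix (Fin n) (Fin n) ℝ) : frobSq (Rᵀ * F) = frobSq F := by
  rw [frobSq_eq_trace, frobSq_eq_trace, transpose_mul, transpose_transpose, mul_assoc,
    ← mul_assoc R, mul_eq_one_comm.mp hR, one_mul]

/-- Here `l` stands for 1/λ, so that μ_c = μ - μl. The factor `l` on the left matches the terms
linear in `RᵀF`; the quadratic remainder is then a multiple of ‖sym‖² + ‖skew‖² = ‖F‖². -/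
lemma energy_rescale {R F : Matrix (Fin 3) (Fin 3) ℝ}
    (hR : R ∈ specialOrthogonalGroup (Fin 3) ℝ) (μ l : ℝ) :
    l * energy μ (μ - μ * l) R F =
      μ * energy 1 0 R (l • F) + (l * (μ - μ * l) * frobSq F + 3 * μ * l - 3 * μ) := by
  rw [← frobSq_transpose_mul (mem_SO_iff.mp hR).1 F, energy, energy, Matrix.mul_smul]
  generalize Rᵀ * F = Y
  simp [frobSq, symPart, skewPart, Fin.sum_univ_three, one_apply]
  ring

lemma rpolarSet_rescaled {F : Matrix (Fin 3) (Fin 3) ℝ} {μ μc : ℝ} (h0 : 0 ≤ μc) (h : μc < μ) :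
    rpolarSet μ μc F = rpolarSet 1 0 (rescaled μ μc F) := by
  have hμ : 0 < μ := by linarith
  have hl : 0 < (scaling μ μc)⁻¹ := inv_pos.mpr (div_pos hμ (by linarith))
  have hc : μc = μ - μ * (scaling μ μc)⁻¹ := by
    rw [scaling, inv_div, mul_div_cancel₀ _ hμ.ne']
    ring
  unfold rescaled
  generalize (scaling μ μc)⁻¹ = l at hl hc
  subst hc
  ext R
  refine and_congr_right fun hR => forall₂_congr fun R' hR' => ?_
  rw [← mul_le_mul_iff_right₀ hl, energy_rescale hR, energy_rescale hR', add_le_add_iff_right,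
    mul_le_mul_iff_right₀ hμ]

end Cosserat

end

theorem mainTheorem2 (F : Matrix (Fin 3) (Fin 3) ℝ) (hF : 0 < F.det)
    (h12 : Cosserat.sv F 1 < Cosserat.sv F 0) (h23 : Cosserat.sv F 2 < Cosserat.sv F 1) :
    (∃ Q, Cosserat.IsPrincipalFrame F Q) ∧
    ∀ Q, Cosserat.IsPrincipalFrame F Q →
      -- the limit case `(1, 0)`
      ((Cosserat.sv F 0 + Cosserat.sv F 1 ≤ 2 →
          Cosserat.rpolarSet 1 0 F = {Cosserat.polar F}) ∧
        (2 ≤ Cosserat.sv F 0 + Cosserat.sv F 1 →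
          Cosserat.rpolarSet 1 0 F =
            {Cosserat.polar F * Q * Cosserat.relRot (-1) F * Qᵀ,
              Cosserat.polar F * Q * Cosserat.relRot 1 F * Qᵀ} ∧
          ∀ ε : ℤˣ, Cosserat.rpolarBranch ε F Q =
            Cosserat.polar F * Q * Cosserat.relRot (-ε) F * Qᵀ) ∧
        Cosserat.rpolarSet 1 0 F =
          {Cosserat.rpolarBranch 1 F Q, Cosserat.rpolarBranch (-1) F Q}) ∧
      -- the whole range `μ > μ_c ≥ 0`
      ∀ μ μc : ℝ, 0 ≤ μc → μc < μ →
        Cosserat.rpolarSet μ μc F = Cosserat.rpolarSet 1 0 (Cosserat.rescaled μ μc F) ∧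
        Cosserat.IsPrincipalFrame (Cosserat.rescaled μ μc F) Q ∧
        Cosserat.rpolarSet μ μc F =
          {Cosserat.rpolarBranch 1 (Cosserat.rescaled μ μc F) Q,
            Cosserat.rpolarBranch (-1) (Cosserat.rescaled μ μc F) Q} := by
  open Cosserat in
  have main : ∀ G Q, IsPrincipalFrame G Q → 0 < G.det → sv G 1 < sv G 0 → sv G 2 < sv G 1 →
      rpolarSet 1 0 G = {rpolarBranch 1 G Q, rpolarBranch (-1) G Q} := by
    intro G Q hQ hG h1 h2
    rw [rpolarBranch_eq hQ.1, rpolarBranch_eq hQ.1, neg_neg]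
    exact hQ.rpolarSet_eq hG h1 h2
  refine ⟨Cosserat.exists_isPrincipalFrame F, fun Q hQ => ⟨⟨fun h => ?_, fun _ =>
    ⟨hQ.rpolarSet_eq hF h12 h23, Cosserat.rpolarBranch_eq hQ.1⟩, main F Q hQ hF h12 h23⟩, ?_⟩⟩
  · rw [main F Q hQ hF h12 h23, Cosserat.rpolarBranch, Cosserat.rpolarBranch, if_pos h, if_pos h,
      Set.pair_eq_singleton]
  · intro μ μc h0 h
    have hl : 0 < (Cosserat.scaling μ μc)⁻¹ :=
      inv_pos.mpr (div_pos (by linarith) (by linarith))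
    obtain ⟨hQ', e0, e1, e2⟩ := hQ.smul hl.le
    refine ⟨Cosserat.rpolarSet_rescaled h0 h, hQ', ?_⟩
    rw [Cosserat.rpolarSet_rescaled h0 h]
    refine main _ Q hQ' ?_ ?_ ?_
    · rw [Cosserat.rescaled, Matrix.det_smul]
      positivity
    · rw [Cosserat.rescaled, e0, e1]
      exact mul_lt_mul_of_pos_left h12 hl
    · rw [Cosserat.rescaled, e1, e2]
      exact mul_lt_mul_of_pos_left h23 hl
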